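/- Let $(\mathsf A_p)_{p\in\mathcal P}$ be a (possibly infinite) family of adjacency matrices of weighted digraphs on the node set $\{1,\dots,N\}$ whose nonzero entries all lie in one interval $[\underline a,\bar a]$ with $0<\underline a\le\bar a$. Let $\Gamma(\mathsf A_p)$ be the digraph with an edge $(i,j)$ whenever $(\mathsf A_p)_{ij}>0$, and let $\mathsf L_p=\mathrm{diag}(\mathsf A_p\mathbf 1)-\mathsf A_p$ be the out-Laplacian. Let $\mathcal S$ be an admissible set of switching signals, that is, a set of right-continuous piecewise constant signals $\sigma:[0,\infty)\to\mathcal P$ for which there are constants $t_L>0$ and $T$ such that every $\sigma\in\mathcal S$ has switching times $0=t_0<t_1<t_2<\cdots$ (where $\sigma$ is constant on each $[t_k,t_{k+1})$; it need not actually change its value at $t_k$) with the following properties: - $t_{k+1}-t_k>t_L$ for all $k\ge 0$ (dwell time); - $\Gamma(\mathsf A_{\sigma(t)})$ is weight-balanced for every $t\ge 0$, i.e. at each node the weighted in-degree and the weighted out-degree coincide; - there are indices $0=i_1<i_2<\cdots$ such that, for every $j\ge 1$, the interval $[t_{i_j},t_{i_{j+1}})$ has length at most $T$ and the union of the digraphs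 $\Gamma(\mathsf A_{\sigma(t)})$ over $t\in[t_{i_j},t_{i_{j+1}})$ is strongly connected. Then for all $\alpha,\beta>0$ there exist $\kappa,\chi>0$ such that for every $\sigma\in\mathcal S$ and every initial condition $y(0),w(0)\in\mathbb R^N$ the trajectory of the switched system $$\dot y=-\alpha y-\beta\,\mathsf L_{\sigma(t)}\,y-w,\qquad \dot w=\alpha\beta\,\mathsf L_{\sigma(t)}\,y$$ satisfies, for every $i\in\{1,\dots,N\}$, $$y^i(t)\to-\frac{\alpha^{-1}}{N}\sum_{j=1}^N w^j(0),\qquad w^i(t)\to\frac1N\sum_{j=1}^N w^j(0)\qquad(t\to\infty),$$ exponentially fast: writing $x=(y,w)\in\mathbb R^{2N}$ and $x_\infty$ for the above limit, $$\|x(t)-x_\infty\|\le\kappa\,e^{-\chi t}\,\|x(0)-x_\infty\|\qquad\text{for all }t\ge 0 .$$ -/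

import Mathlib

open Filter Topology

/-- Digraph induced by an adjacency matrix: `(i, j)` is an edge iff `a i j > 0`. -/
def inducedDigraph {N : ℕ} (A : Matrix (Fin N) (Fin N) ℝ) : Digraph (Fin N) where
  Adj i j := 0 < A i j

/-- Any two vertices are joined by a directed path. -/
def IsStronglyConnectedDigraph {V : Type*} (G : Digraph V) : Prop :=
  ∀ i j : V, Relation.ReflTransGen G.Adj i j

/-- Weighted out-degree `∑ j, a i j`. -/
def outDegree {N : ℕ} (A : Matrix (Fin N) (Fin N) ℝ) (i : Fin N) : ℝ := ∑ j, A i j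

/-- Weighted in-degree `∑ j, a j i`. -/
def inDegree {N : ℕ} (A : Matrix (Fin N) (Fin N) ℝ) (i : Fin N) : ℝ := ∑ j, A j i

/-- At each node the weighted out-degree and in-degree coincide. -/
def IsWeightBalanced {N : ℕ} (A : Matrix (Fin N) (Fin N) ℝ) : Prop :=
  ∀ i, outDegree A i = inDegree A i

/-- The out-Laplacian `L = D_out - A`. -/
def outLaplacian {N : ℕ} (A : Matrix (Fin N) (Fin N) ℝ) : Matrix (Fin N) (Fin N) ℝ :=
  Matrix.diagonal (outDegree A) - A

/-- The adjacency matrices of the family have nonzero entries uniformly bounded below and above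
by positive numbers. -/
def HasUniformWeights {P : Type*} {N : ℕ} (A : P → Matrix (Fin N) (Fin N) ℝ) : Prop :=
  ∃ a b : ℝ, 0 < a ∧ a ≤ b ∧ ∀ p i j, A p i j = 0 ∨ A p i j ∈ Set.Icc a b

/-- Joint digraph of the switching topology over the time interval `[t₁, t₂)`. -/
def jointDigraph {P : Type*} {N : ℕ} (A : P → Matrix (Fin N) (Fin N) ℝ) (σ : ℝ → P)
    (t₁ t₂ : ℝ) : Digraph (Fin N) :=
  ⨆ s ∈ Set.Ico t₁ t₂, inducedDigraph (A (σ s))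

/-- `σ`, restricted to `[0, ∞)`, is a right-continuous piecewise constant signal with (possible)
switching times `t 0 = 0 < t 1 < t 2 < ⋯` and dwell time `tL`.  The value of `σ` may also
stay the same at some `t k`; in this way signals with finitely many jumps are included. -/
structure IsSwitchingSignal {P : Type*} (tL : ℝ) (t : ℕ → ℝ) (σ : ℝ → P) : Prop where
  start : t 0 = 0
  dwell : ∀ k, tL < t (k + 1) - t k
  const : ∀ k, ∀ s ∈ Set.Ico (t k) (t (k + 1)), σ s = σ (t k)

/-- Admissibility of a signal with dwell time `tL` and interval bound `T`: the digraph is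
weight-balanced at all times `s ≥ 0`, and there is an infinite sequence of contiguous, nonempty
intervals `[t (i j), t (i (j + 1)))` between switching times, starting at `t 0 = 0`, of length at
most `T`, over each of which the digraph is jointly strongly connected. -/
def IsAdmissibleSignal {P : Type*} {N : ℕ} (A : P → Matrix (Fin N) (Fin N) ℝ) (tL T : ℝ)
    (σ : ℝ → P) : Prop :=
  ∃ t : ℕ → ℝ, IsSwitchingSignal tL t σ ∧
    (∀ s, 0 ≤ s → IsWeightBalanced (A (σ s))) ∧
    ∃ i : ℕ → ℕ, i 0 = 0 ∧ StrictMono i ∧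
      ∀ j, t (i (j + 1)) - t (i j) ≤ T ∧
        IsStronglyConnectedDigraph (jointDigraph A σ (t (i j)) (t (i (j + 1))))

/-- An admissible switching set: its signals have a common dwell time and a common bound for the
lengths of the intervals of joint strong connectivity. -/
def IsAdmissibleSet {P : Type*} {N : ℕ} (A : P → Matrix (Fin N) (Fin N) ℝ)
    (S : Set (ℝ → P)) : Prop :=
  ∃ tL T : ℝ, 0 < tL ∧ ∀ σ ∈ S, IsAdmissibleSignal A tL T σ

/-- The matrix `[[-α I - β L, -I], [α β L, 0]]`. -/
def systemMatrix {N : ℕ} (α β : ℝ) (L : Matrix (Fin N) (Fin N) ℝ) :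
    Matrix (Fin N ⊕ Fin N) (Fin N ⊕ Fin N) ℝ :=
  Matrix.fromBlocks (-(α • (1 : Matrix (Fin N) (Fin N) ℝ)) - β • L) (-1) ((α * β) • L) 0

/-- The state `(y, w)` as one vector. -/
def stackedState {N : ℕ} (y w : Fin N → ℝ) : EuclideanSpace ℝ (Fin N ⊕ Fin N) :=
  WithLp.toLp 2 (Sum.elim y w)

/-- Trajectories on `[0, ∞)` of the switched system: continuous, with the differential equation
satisfied at every time `t ≥ 0` by the right derivative.  As `σ` is piecewise constant and
right-continuous, this is the same as being continuous and satisfying the equation with the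
ordinary derivative at every time at which `σ` does not switch. -/
structure IsTrajectory {P : Type*} {N : ℕ} (A : P → Matrix (Fin N) (Fin N) ℝ) (α β : ℝ)
    (σ : ℝ → P) (y w : ℝ → Fin N → ℝ) : Prop where
  cont_y : ContinuousOn y (Set.Ici 0)
  cont_w : ContinuousOn w (Set.Ici 0)
  deriv : ∀ t, 0 ≤ t → HasDerivWithinAt (fun s => Sum.elim (y s) (w s))
    ((systemMatrix α β (outLaplacian (A (σ t)))).mulVec (Sum.elim (y t) (w t))) (Set.Ici t) t

/-- Average of the components of a vector. -/
noncomputable def avg {N : ℕ} (v : Fin N → ℝ) : ℝ := (∑ j, v j) / N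

/-! With v = w - `avg (w 0)` and z = w + αy the system becomes the cascade z' = -αz, v' = βL(z - v),
and weight balance keeps Σ v = 0. The function W = Σ v² + M Σ z² (`lyapunov`), with M large enough
to absorb the cross term, decreases at least at the rate `dissipation`. At a single instant this
rate may vanish although v ≠ 0, since only the joint digraph is strongly connected.

The remedy is to argue over a whole joint interval. If W drops there by at most d², every v_i moves
by O(d) (`IsCascadeTrajectory.abs_sub_le`). An edge whose initial gap is a large multiple of d would
keep a large gap throughout a dwell interval on which it is active, and dissipate more than d². So
gaps along joint edges are O(d); by strong connectivity and zero sum v is O(d), and z is O(d) by its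
explicit decay. Hence W ≤ C · (drop of W) with C uniform (`exists_lyapunov_le_mul_sub`), W decays
geometrically (`exists_lyapunov_le_exp`), and W is comparable to the squared error norm
(`exists_sq_bounds_lyapunov`). All constants depend only on N, the weight bounds, α, β, tL and T. -/

/-- The weighted disagreement `∑ i j, a i j * (v i - v j) ^ 2`. -/
def disagreement {N : ℕ} (A : Matrix (Fin N) (Fin N) ℝ) (v : Fin N → ℝ) : ℝ :=
  ∑ i, ∑ j, A i j * (v i - v j) ^ 2

/-- The sum of squares of the components. -/
def sumSq {N : ℕ} (v : Fin N → ℝ) : ℝ := ∑ i, v i ^ 2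

/-- The coefficient of the damped component in the Lyapunov function. -/
noncomputable def dampingWeight (N : ℕ) (α β b : ℝ) : ℝ := 1 + β * N * b / α

/-- The Lyapunov function `∑ v² + M ∑ z²`, where `M = 1 + β N b / α`. -/
noncomputable def lyapunov {N : ℕ} (α β b : ℝ) (v z : Fin N → ℝ) : ℝ :=
  sumSq v + dampingWeight N α β b * sumSq z

/-- The guaranteed rate of decrease of the Lyapunov function. -/
noncomputable def dissipation {N : ℕ} (A : Matrix (Fin N) (Fin N) ℝ) (α β : ℝ)
    (v z : Fin N → ℝ) : ℝ :=
  β / 2 * disagreement A v + 2 * α * sumSq z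

/-- The consensus flow `β L (z - v)`. -/
def consensusFlow {N : ℕ} (A : Matrix (Fin N) (Fin N) ℝ) (β : ℝ) (v z : Fin N → ℝ)
    (i : Fin N) : ℝ :=
  β * ∑ j, A i j * ((z i - z j) - (v i - v j))

/-! ### Pointwise estimates for a fixed adjacency matrix. -/

lemma sumSq_nonneg {N : ℕ} (v : Fin N → ℝ) : 0 ≤ sumSq v :=
  Finset.sum_nonneg fun _ _ => sq_nonneg _

lemma sq_le_sumSq {N : ℕ} (v : Fin N → ℝ) (i : Fin N) : v i ^ 2 ≤ sumSq v :=
  Finset.single_le_sum (f := fun i => v i ^ 2) (fun _ _ => sq_nonneg _) (Finset.mem_univ i)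

lemma disagreement_nonneg {N : ℕ} {A : Matrix (Fin N) (Fin N) ℝ} (hA : ∀ i j, 0 ≤ A i j)
    (v : Fin N → ℝ) : 0 ≤ disagreement A v :=
  Finset.sum_nonneg fun i _ => Finset.sum_nonneg fun j _ => mul_nonneg (hA i j) (sq_nonneg _)

lemma sum_mul_sq_le_disagreement {N : ℕ} {A : Matrix (Fin N) (Fin N) ℝ}
    (hA : ∀ i j, 0 ≤ A i j) (v : Fin N → ℝ) (i : Fin N) :
    ∑ j, A i j * (v i - v j) ^ 2 ≤ disagreement A v :=
  Finset.single_le_sum (f := fun i => ∑ j, A i j * (v i - v j) ^ 2)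
    (fun i _ => Finset.sum_nonneg fun j _ => mul_nonneg (hA i j) (sq_nonneg _))
    (Finset.mem_univ i)

lemma mul_sq_le_disagreement {N : ℕ} {A : Matrix (Fin N) (Fin N) ℝ}
    (hA : ∀ i j, 0 ≤ A i j) (v : Fin N → ℝ) (i j : Fin N) :
    A i j * (v i - v j) ^ 2 ≤ disagreement A v :=
  (Finset.single_le_sum (f := fun j => A i j * (v i - v j) ^ 2)
    (fun j _ => mul_nonneg (hA i j) (sq_nonneg _)) (Finset.mem_univ j)).trans
    (sum_mul_sq_le_disagreement hA v i)

lemma dissipation_nonneg {N : ℕ} {A : Matrix (Fin N) (Fin N) ℝ} (hA : ∀ i j, 0 ≤ A i j)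
    {α β : ℝ} (hα : 0 < α) (hβ : 0 < β) (v z : Fin N → ℝ) : 0 ≤ dissipation A α β v z := by
  have h1 := disagreement_nonneg hA v
  have h2 := sumSq_nonneg z
  unfold dissipation
  positivity

/-- The coefficients of f i are the out-degree and the in-degree of i. Weight balance enters the
argument only through this identity. -/
lemma IsWeightBalanced.sum_sub_eq_zero {N : ℕ} {A : Matrix (Fin N) (Fin N) ℝ}
    (h : IsWeightBalanced A) (f : Fin N → ℝ) : ∑ i, ∑ j, A i j * (f i - f j) = 0 := by
  have h1 : ∑ i, ∑ j, A i j * f i = ∑ i, ∑ j, A i j * f j := by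
    rw [Finset.sum_comm (f := fun i j => A i j * f j)]
    refine Finset.sum_congr rfl fun i _ => ?_
    rw [← Finset.sum_mul, ← Finset.sum_mul]
    exact congrArg (· * f i) (h i)
  simp only [mul_sub, Finset.sum_sub_distrib, h1, sub_self]

lemma IsWeightBalanced.two_mul_sum_mul_consensusFlow_le {N : ℕ} {A : Matrix (Fin N) (Fin N) ℝ}
    (h : IsWeightBalanced A) {b : ℝ} (hA : ∀ i j, 0 ≤ A i j) (hb : ∀ i j, A i j ≤ b)
    {β : ℝ} (hβ : 0 < β) (v z : Fin N → ℝ) :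
    ∑ i, 2 * v i * consensusFlow A β v z i ≤
      -(β / 2 * disagreement A v) + 2 * (β * N * b) * sumSq z := by
  have key : ∑ i, ∑ j, A i j * (2 * v i * ((z i - z j) - (v i - v j))) ≤
      ∑ i, ∑ j, (A i j * ((2 * v i * z i - v i ^ 2) - (2 * v j * z j - v j ^ 2)) -
        1 / 2 * (A i j * (v i - v j) ^ 2) + 2 * b * z j ^ 2) := by
    refine Finset.sum_le_sum fun i _ => Finset.sum_le_sum fun j _ => ?_
    -- Half of this square is the gap between the two sides, before z j ^ 2 is weighted by b. The
    -- differences of 2 v z - v² vanish in the sum by weight balance.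
    have h1 : 0 ≤ A i j * (v i - v j + 2 * z j) ^ 2 := mul_nonneg (hA i j) (sq_nonneg _)
    have h2 : A i j * z j ^ 2 ≤ b * z j ^ 2 := mul_le_mul_of_nonneg_right (hb i j) (sq_nonneg _)
    linarith
  have e1 : ∑ i, 2 * v i * consensusFlow A β v z i =
      β * ∑ i, ∑ j, A i j * (2 * v i * ((z i - z j) - (v i - v j))) := by
    simp only [consensusFlow, Finset.mul_sum]
    exact Finset.sum_congr rfl fun i _ => Finset.sum_congr rfl fun j _ => by ring
  have e2 : ∑ i, ∑ j, (A i j * ((2 * v i * z i - v i ^ 2) - (2 * v j * z j - v j ^ 2)) -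
        1 / 2 * (A i j * (v i - v j) ^ 2) + 2 * b * z j ^ 2) =
      -(1 / 2 * disagreement A v) + 2 * (N * b) * sumSq z := by
    simp only [Finset.sum_add_distrib, Finset.sum_sub_distrib,
      h.sum_sub_eq_zero fun i => 2 * v i * z i - v i ^ 2, ← Finset.mul_sum]
    simp [disagreement, sumSq]
    ring
  rw [e1]
  calc _ ≤ β * (-(1 / 2 * disagreement A v) + 2 * (N * b) * sumSq z) :=
        mul_le_mul_of_nonneg_left (key.trans_eq e2) hβ.le
    _ = _ := by ring

/-- The speed of v is linear in the gaps while the dissipation is quadratic; Young's inequality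
bridges the two, with a free scale l to be matched to the size of the drop of the Lyapunov function.
-/
lemma abs_consensusFlow_le {N : ℕ} {A : Matrix (Fin N) (Fin N) ℝ} {b : ℝ}
    (hA : ∀ i j, 0 ≤ A i j) (hb : ∀ i j, A i j ≤ b) (hb0 : 0 ≤ b) {α β l : ℝ} (hα : 0 < α)
    (hβ : 0 < β) (hl : 0 < l) (v z : Fin N → ℝ) (i : Fin N) :
    |consensusFlow A β v z i| ≤
      β * N * b * l + (4 + 2 * β * b * (N + 1) / α) / l * dissipation A α β v z := by
  have habs : ∀ x : ℝ, |x| ≤ l + x ^ 2 / l := fun x => by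
    have h : l * |x| ≤ l * (l + x ^ 2 / l) := by
      rw [mul_add, mul_div_cancel₀ _ hl.ne', ← sq_abs x]
      nlinarith [sq_nonneg (l - |x|), mul_nonneg hl.le (abs_nonneg x)]
    exact le_of_mul_le_mul_left h hl
  have hterm : ∀ j, |A i j * ((z i - z j) - (v i - v j))| ≤
      b * l + (2 * (A i j * (v i - v j) ^ 2) + 4 * b * z i ^ 2 + 4 * b * z j ^ 2) / l := by
    intro j
    rw [abs_mul, abs_of_nonneg (hA i j)]
    have h1 : ((z i - z j) - (v i - v j)) ^ 2 ≤
        2 * (v i - v j) ^ 2 + 4 * z i ^ 2 + 4 * z j ^ 2 := by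
      nlinarith [sq_nonneg ((z i - z j) + (v i - v j)), sq_nonneg (z i + z j)]
    have h2 : A i j * ((z i - z j) - (v i - v j)) ^ 2 ≤
        2 * (A i j * (v i - v j) ^ 2) + 4 * b * z i ^ 2 + 4 * b * z j ^ 2 := by
      have h3 := mul_le_mul_of_nonneg_left h1 (hA i j)
      have h4 := mul_le_mul_of_nonneg_right (hb i j) (sq_nonneg (z i))
      have h5 := mul_le_mul_of_nonneg_right (hb i j) (sq_nonneg (z j))
      linarith
    calc _ ≤ A i j * (l + ((z i - z j) - (v i - v j)) ^ 2 / l) :=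
          mul_le_mul_of_nonneg_left (habs _) (hA i j)
      _ = A i j * l + (A i j * ((z i - z j) - (v i - v j)) ^ 2) / l := by ring
      _ ≤ _ := add_le_add (mul_le_mul_of_nonneg_right (hb i j) hl.le)
          (div_le_div_of_nonneg_right h2 hl.le)
  have hsum : ∑ j, |A i j * ((z i - z j) - (v i - v j))| ≤
      N * b * l + (2 * disagreement A v + 4 * b * (N + 1) * sumSq z) / l := by
    refine (Finset.sum_le_sum fun j _ => hterm j).trans ?_
    rw [Finset.sum_add_distrib, ← Finset.sum_div]
    simp only [Finset.sum_add_distrib, ← Finset.mul_sum, Finset.sum_const, Finset.card_univ,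
      Fintype.card_fin, nsmul_eq_mul]
    have h1 := sum_mul_sq_le_disagreement hA v i
    have h2 : b * z i ^ 2 * N ≤ b * sumSq z * N := by
      have := sq_le_sumSq z i
      gcongr
    have h3 : ∑ j, z j ^ 2 = sumSq z := rfl
    rw [h3]
    refine add_le_add (by linarith) (div_le_div_of_nonneg_right ?_ hl.le)
    linarith
  have h1 := disagreement_nonneg hA v
  have h2 := sumSq_nonneg z
  have hfin : β * (2 * disagreement A v + 4 * b * (N + 1) * sumSq z) ≤
      (4 + 2 * β * b * (N + 1) / α) * dissipation A α β v z := by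
    -- The summand 4 of the constant pays for the disagreement and the other for `sumSq z`; the
    -- cross products are a nonnegative surplus.
    have e : (4 + 2 * β * b * (N + 1) / α) * dissipation A α β v z =
        β * (2 * disagreement A v + 4 * b * (N + 1) * sumSq z) + (8 * α * sumSq z +
          β * β * b * (N + 1) / α * disagreement A v) := by
      unfold dissipation
      field_simp
      ring
    rw [e]
    have : 0 ≤ 8 * α * sumSq z + β * β * b * (N + 1) / α * disagreement A v := by positivity
    linarith
  unfold consensusFlow
  rw [abs_mul, abs_of_pos hβ]
  calc _ ≤ β * (N * b * l + (2 * disagreement A v + 4 * b * (N + 1) * sumSq z) / l) :=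
        mul_le_mul_of_nonneg_left ((Finset.abs_sum_le_sum_abs _ _).trans hsum) hβ.le
    _ = β * N * b * l + β * (2 * disagreement A v + 4 * b * (N + 1) * sumSq z) / l := by ring
    _ ≤ β * N * b * l + (4 + 2 * β * b * (N + 1) / α) * dissipation A α β v z / l := by
        gcongr
    _ = _ := by ring

/-! ### Comparison of right derivatives, connectivity and partition into dwell intervals. -/

/-- A function whose right derivative is dominated by that of another one grows less. -/
lemma sub_le_sub_of_deriv_right_le {f f' g g' : ℝ → ℝ} {s e : ℝ} (hse : s ≤ e)
    (hf : ContinuousOn f (Set.Icc s e))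
    (hf' : ∀ x ∈ Set.Ico s e, HasDerivWithinAt f (f' x) (Set.Ici x) x)
    (hg : ContinuousOn g (Set.Icc s e))
    (hg' : ∀ x ∈ Set.Ico s e, HasDerivWithinAt g (g' x) (Set.Ici x) x)
    (h : ∀ x ∈ Set.Ico s e, f' x ≤ g' x) : f e - f s ≤ g e - g s := by
  have := image_le_of_deriv_right_le_deriv_boundary (f := fun x => f x - f s)
    (B := fun x => g x - g s) (hf.sub continuousOn_const) (fun x hx => (hf' x hx).sub_const _)
    (by simp) (hg.sub continuousOn_const) (fun x hx => (hg' x hx).sub_const _) h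
    (Set.right_mem_Icc.2 hse)
  exact this

/-- For fixed `N` there is a uniform constant that bounds all differences of a vector by its
differences along the edges of a strongly connected digraph. -/
lemma exists_abs_sub_le_of_isStronglyConnectedDigraph (N : ℕ) :
    ∃ n : ℝ, 0 ≤ n ∧ ∀ G : Digraph (Fin N), IsStronglyConnectedDigraph G →
      ∀ (v : Fin N → ℝ) (r : ℝ), 0 ≤ r → (∀ i j, G.Adj i j → |v i - v j| ≤ r) →
        ∀ i j, |v i - v j| ≤ n * r := by
  -- Path length serves as the constant, or 0 if there is no path. Relations and endpoints range
  -- over a finite type, so a maximum exists.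
  have hex : ∀ p : (Fin N → Fin N → Prop) × Fin N × Fin N, ∃ n : ℝ,
      Relation.ReflTransGen p.1 p.2.1 p.2.2 → ∀ (v : Fin N → ℝ) (r : ℝ), 0 ≤ r →
        (∀ i j, p.1 i j → |v i - v j| ≤ r) → |v p.2.1 - v p.2.2| ≤ n * r := by
    rintro ⟨R, i, j⟩
    by_cases h : Relation.ReflTransGen R i j
    · suffices ∃ n : ℝ, ∀ (v : Fin N → ℝ) (r : ℝ), 0 ≤ r →
          (∀ i j, R i j → |v i - v j| ≤ r) → |v i - v j| ≤ n * r from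
        this.imp fun n hn _ => hn
      induction h with
      | refl => exact ⟨0, fun v r _ _ => by simp⟩
      | tail _ hkl ih =>
        obtain ⟨n, hn⟩ := ih
        refine ⟨n + 1, fun v r hr hv => ?_⟩
        refine (abs_sub_le _ _ _).trans ((add_le_add (hn v r hr hv) (hv _ _ hkl)).trans_eq ?_)
        ring
    · exact ⟨0, fun h' => absurd h' h⟩
  choose n hn using hex
  obtain ⟨M, hM⟩ := Finite.exists_le n
  refine ⟨max M 0, le_max_right _ _, fun G hG v r hr hv i j => ?_⟩
  refine (hn (G.Adj, i, j) (hG i j) v r hr hv).trans ?_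
  exact mul_le_mul_of_nonneg_right ((hM _).trans (le_max_left _ _)) hr

/-- Zero sum gives N v_i = Σ_j (v_i - v_j). -/
lemma sumSq_le_of_abs_sub_le {N : ℕ} {v : Fin N → ℝ} (hv : ∑ i, v i = 0) {r : ℝ}
    (h : ∀ i j, |v i - v j| ≤ r) : sumSq v ≤ N * r ^ 2 := by
  have hi : ∀ i, v i ^ 2 ≤ r ^ 2 := by
    intro i
    have hN : (0 : ℝ) < N := by exact_mod_cast i.pos
    have e : N * v i = ∑ j, (v i - v j) := by simp [Finset.sum_sub_distrib, hv]
    have h1 : |N * v i| ≤ N * r := by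
      rw [e]
      refine (Finset.abs_sum_le_sum_abs _ _).trans
        ((Finset.sum_le_sum fun j _ => h i j).trans_eq ?_)
      simp
    rw [abs_mul, abs_of_pos hN] at h1
    exact sq_le_sq' (by linarith [(abs_le.1 (le_of_mul_le_mul_left h1 hN)).1])
      (abs_le.1 (le_of_mul_le_mul_left h1 hN)).2
  exact (Finset.sum_le_sum fun i _ => hi i).trans_eq (by simp)

lemma exists_mem_Ico_succ {t : ℕ → ℝ} {m n : ℕ} (hmn : m ≤ n) {s : ℝ}
    (hs : s ∈ Set.Ico (t m) (t n)) :
    ∃ k, m ≤ k ∧ k + 1 ≤ n ∧ s ∈ Set.Ico (t k) (t (k + 1)) := by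
  induction n, hmn using Nat.le_induction with
  | base => exact absurd (hs.1.trans_lt hs.2) (lt_irrefl _)
  | succ n hmn ih =>
    by_cases h : s < t n
    · obtain ⟨k, h1, h2, h3⟩ := ih ⟨hs.1, h⟩
      exact ⟨k, h1, h2.trans n.le_succ, h3⟩
    · exact ⟨n, hmn, le_rfl, not_lt.1 h, hs.2⟩

/-! ### The cascade and its Lyapunov function. -/

/-- A trajectory, with zero sum in the first component, of the cascade
`v' = β L (z - v)`, `z' = -α z` with time-dependent Laplacian. -/
structure IsCascadeTrajectory {N : ℕ} (A : ℝ → Matrix (Fin N) (Fin N) ℝ) (α β : ℝ)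
    (v z : ℝ → Fin N → ℝ) : Prop where
  cont_v : ContinuousOn v (Set.Ici 0)
  cont_z : ContinuousOn z (Set.Ici 0)
  deriv_v : ∀ t, 0 ≤ t → ∀ i,
    HasDerivWithinAt (fun s => v s i) (consensusFlow (A t) β (v t) (z t) i) (Set.Ici t) t
  deriv_z : ∀ t, 0 ≤ t → ∀ i, HasDerivWithinAt (fun s => z s i) (-α * z t i) (Set.Ici t) t
  sum_v : ∀ t, 0 ≤ t → ∑ i, v t i = 0

/-- The digraph is weight-balanced with weights in `{0} ∪ [a, b]` at all times `t ≥ 0`. -/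
structure IsBalancedWithin {N : ℕ} (A : ℝ → Matrix (Fin N) (Fin N) ℝ) (a b : ℝ) : Prop where
  pos : 0 < a
  le : a ≤ b
  weights : ∀ t i j, A t i j = 0 ∨ A t i j ∈ Set.Icc a b
  balanced : ∀ t, 0 ≤ t → IsWeightBalanced (A t)

namespace IsBalancedWithin

variable {N : ℕ} {A : ℝ → Matrix (Fin N) (Fin N) ℝ} {a b : ℝ}

lemma upper_nonneg (h : IsBalancedWithin A a b) : 0 ≤ b := h.pos.le.trans h.le

lemma entry_nonneg (h : IsBalancedWithin A a b) (t : ℝ) (i j : Fin N) : 0 ≤ A t i j := by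
  rcases h.weights t i j with h0 | h0
  · exact h0.ge
  · exact h.pos.le.trans h0.1

lemma entry_le (h : IsBalancedWithin A a b) (t : ℝ) (i j : Fin N) : A t i j ≤ b := by
  rcases h.weights t i j with h0 | h0
  · exact h0.trans_le h.upper_nonneg
  · exact h0.2

lemma le_entry (h : IsBalancedWithin A a b) {t : ℝ} {i j : Fin N} (hij : 0 < A t i j) :
    a ≤ A t i j :=
  (h.weights t i j).elim (fun h0 => absurd h0 hij.ne') fun h0 => h0.1

end IsBalancedWithin

lemma HasDerivWithinAt.sumSq {N : ℕ} {v : ℝ → Fin N → ℝ} {v' : Fin N → ℝ} {s : Set ℝ} {t : ℝ}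
    (h : ∀ i, HasDerivWithinAt (fun s => v s i) (v' i) s t) :
    HasDerivWithinAt (fun s => sumSq (v s)) (∑ i, 2 * v t i * v' i) s t := by
  unfold _root_.sumSq
  refine HasDerivWithinAt.fun_sum fun i _ => ?_
  simpa using (h i).fun_pow 2

lemma ContinuousOn.sumSq {N : ℕ} {v : ℝ → Fin N → ℝ} {s : Set ℝ} (h : ContinuousOn v s) :
    ContinuousOn (fun t => sumSq (v t)) s := by
  unfold _root_.sumSq
  exact continuousOn_finsetSum _ fun i _ => ((continuousOn_pi.1 h) i).pow 2

namespace IsCascadeTrajectory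

variable {N : ℕ} {A : ℝ → Matrix (Fin N) (Fin N) ℝ} {a b α β : ℝ} {v z : ℝ → Fin N → ℝ}

lemma continuousOn_lyapunov (h : IsCascadeTrajectory A α β v z) :
    ContinuousOn (fun t => lyapunov α β b (v t) (z t)) (Set.Ici 0) :=
  h.cont_v.sumSq.add (continuousOn_const.mul h.cont_z.sumSq)

lemma hasDerivWithinAt_sumSq_z (h : IsCascadeTrajectory A α β v z) {t : ℝ} (ht : 0 ≤ t) :
    HasDerivWithinAt (fun s => sumSq (z s)) (-(2 * α) * sumSq (z t)) (Set.Ici t) t := by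
  convert HasDerivWithinAt.sumSq (h.deriv_z t ht) using 1
  rw [_root_.sumSq, Finset.mul_sum]
  exact Finset.sum_congr rfl fun i _ => by ring

/-- The part βNb/α of `dampingWeight` cancels the cross term of the consensus flow; the part 1
leaves -2α Σ z². -/
lemma exists_hasDerivWithinAt_lyapunov (h : IsCascadeTrajectory A α β v z)
    (hA : IsBalancedWithin A a b) (hα : 0 < α) (hβ : 0 < β) :
    ∃ W' : ℝ → ℝ, ∀ t, 0 ≤ t →
      HasDerivWithinAt (fun s => lyapunov α β b (v s) (z s)) (W' t) (Set.Ici t) t ∧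
        W' t ≤ -dissipation (A t) α β (v t) (z t) := by
  refine ⟨_, fun t ht => ⟨(HasDerivWithinAt.sumSq (h.deriv_v t ht)).add
    ((h.hasDerivWithinAt_sumSq_z ht).const_mul (dampingWeight N α β b)), ?_⟩⟩
  have h1 := (hA.balanced t ht).two_mul_sum_mul_consensusFlow_le (hA.entry_nonneg t)
    (hA.entry_le t) hβ (v t) (z t)
  have e : dampingWeight N α β b * (-(2 * α) * sumSq (z t)) =
      -(2 * (β * N * b) * sumSq (z t)) - 2 * α * sumSq (z t) := by
    unfold dampingWeight
    field_simp
    ring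
  rw [e]
  unfold dissipation
  linarith

lemma lyapunov_le_sub (h : IsCascadeTrajectory A α β v z) (hA : IsBalancedWithin A a b)
    (hα : 0 < α) (hβ : 0 < β) {s e c : ℝ} (hs : 0 ≤ s) (hse : s ≤ e)
    (hc : ∀ t ∈ Set.Ico s e, c ≤ dissipation (A t) α β (v t) (z t)) :
    lyapunov α β b (v e) (z e) ≤ lyapunov α β b (v s) (z s) - c * (e - s) := by
  obtain ⟨W', hW⟩ := h.exists_hasDerivWithinAt_lyapunov hA hα hβ
  have := sub_le_sub_of_deriv_right_le (g := fun t => -c * t) (g' := fun _ => -c) hse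
    (h.continuousOn_lyapunov.mono fun t ht => hs.trans ht.1)
    (fun t ht => (hW t (hs.trans ht.1)).1) (by fun_prop)
    (fun t _ => by simpa using (hasDerivWithinAt_id t (Set.Ici t)).const_mul (-c))
    (fun t ht => (hW t (hs.trans ht.1)).2.trans (neg_le_neg (hc t ht)))
  linarith

lemma lyapunov_antitone (h : IsCascadeTrajectory A α β v z) (hA : IsBalancedWithin A a b)
    (hα : 0 < α) (hβ : 0 < β) {s e : ℝ} (hs : 0 ≤ s) (hse : s ≤ e) :
    lyapunov α β b (v e) (z e) ≤ lyapunov α β b (v s) (z s) := by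
  have := h.lyapunov_le_sub hA hα hβ hs hse
    (fun t _ => dissipation_nonneg (hA.entry_nonneg t) hα hβ (v t) (z t))
  linarith

/-- The derivative of Σ z² is exactly -2α Σ z², which is at least the derivative of the Lyapunov
function. -/
lemma sumSq_z_sub_le (h : IsCascadeTrajectory A α β v z) (hA : IsBalancedWithin A a b)
    (hα : 0 < α) (hβ : 0 < β) {s e : ℝ} (hs : 0 ≤ s) (hse : s ≤ e) :
    sumSq (z s) - sumSq (z e) ≤
      lyapunov α β b (v s) (z s) - lyapunov α β b (v e) (z e) := by
  obtain ⟨W', hW⟩ := h.exists_hasDerivWithinAt_lyapunov hA hα hβ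
  have hsub : Set.Icc s e ⊆ Set.Ici 0 := fun t ht => hs.trans ht.1
  have := sub_le_sub_of_deriv_right_le hse
    (h.continuousOn_lyapunov.mono hsub)
    (fun t ht => (hW t (hs.trans ht.1)).1) (h.cont_z.sumSq.mono hsub)
    (fun t ht => h.hasDerivWithinAt_sumSq_z (hs.trans ht.1))
    (fun t ht => (hW t (hs.trans ht.1)).2.trans ?_)
  · linarith
  · have := disagreement_nonneg (hA.entry_nonneg t) (v t)
    unfold dissipation
    nlinarith

lemma sumSq_z_le_exp (h : IsCascadeTrajectory A α β v z) {s e : ℝ} (hs : 0 ≤ s)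
    (hse : s ≤ e) : sumSq (z e) ≤ Real.exp (-(2 * α) * (e - s)) * sumSq (z s) := by
  -- Integrating factor.
  have hd : ∀ t ∈ Set.Ico s e, HasDerivWithinAt
      (fun t => Real.exp (2 * α * t) * sumSq (z t)) 0 (Set.Ici t) t := by
    intro t ht
    have h1 : HasDerivWithinAt (fun t => Real.exp (2 * α * t))
        (Real.exp (2 * α * t) * (2 * α)) (Set.Ici t) t := by
      simpa using ((hasDerivWithinAt_id t (Set.Ici t)).const_mul (2 * α)).exp
    exact (h1.mul (h.hasDerivWithinAt_sumSq_z (hs.trans ht.1))).congr_deriv (by ring)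
  have hc : Real.exp (2 * α * e) * sumSq (z e) = Real.exp (2 * α * s) * sumSq (z s) :=
    constant_of_has_deriv_right_zero
    (((by fun_prop : Continuous fun t => Real.exp (2 * α * t)).continuousOn).mul
      (h.cont_z.sumSq.mono fun t ht => hs.trans ht.1)) hd e (Set.right_mem_Icc.2 hse)
  have e1 : Real.exp (-(2 * α) * (e - s)) = Real.exp (-(2 * α * e)) * Real.exp (2 * α * s) := by
    rw [← Real.exp_add]
    ring_nf
  rw [e1, mul_assoc, ← hc, ← mul_assoc, ← Real.exp_add]
  simp

/-- Integrates `abs_consensusFlow_le`, with the loss of the Lyapunov function bounding the integral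
of the dissipation. For l = d and a loss of at most d², the displacement is O(d) over bounded time.
-/
lemma abs_sub_le (h : IsCascadeTrajectory A α β v z) (hA : IsBalancedWithin A a b)
    (hα : 0 < α) (hβ : 0 < β) {s e l : ℝ} (hl : 0 < l) (hs : 0 ≤ s) (hse : s ≤ e)
    (i : Fin N) :
    |v e i - v s i| ≤ β * N * b * l * (e - s) + (4 + 2 * β * b * (N + 1) / α) / l *
      (lyapunov α β b (v s) (z s) - lyapunov α β b (v e) (z e)) := by
  obtain ⟨W', hW⟩ := h.exists_hasDerivWithinAt_lyapunov hA hα hβ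
  have hsub : Set.Icc s e ⊆ Set.Ici 0 := fun t ht => hs.trans ht.1
  set K : ℝ := (4 + 2 * β * b * (N + 1) / α) / l with hK
  have hb := hA.upper_nonneg
  have hK0 : 0 ≤ K := by positivity
  refine image_norm_le_of_norm_deriv_right_le_deriv_boundary' (f := fun t => v t i - v s i)
    (f' := fun t => consensusFlow (A t) β (v t) (z t) i)
    (B := fun t => β * N * b * l * (t - s) + K *
      (lyapunov α β b (v s) (z s) - lyapunov α β b (v t) (z t)))
    (B' := fun t => β * N * b * l * 1 + K * (-(W' t)))
    ((((continuousOn_pi.1 h.cont_v) i).mono hsub).sub continuousOn_const)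
    (fun t ht => (h.deriv_v t (hs.trans ht.1) i).sub_const _) (by simp)
    ((by fun_prop : Continuous fun t => β * N * b * l * (t - s)).continuousOn.add
      (continuousOn_const.mul (continuousOn_const.sub (h.continuousOn_lyapunov.mono hsub))))
    (fun t ht => (((hasDerivWithinAt_id t (Set.Ici t)).sub_const s).const_mul _).add
      (((hW t (hs.trans ht.1)).1.const_sub _).const_mul K))
    (fun t ht => ?_) (Set.right_mem_Icc.2 hse)
  refine (abs_consensusFlow_le (hA.entry_nonneg t) (hA.entry_le t) hb hα hβ hl
    (v t) (z t) i).trans ?_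
  have h1 := mul_le_mul_of_nonneg_left (hW t (hs.trans ht.1)).2 hK0
  rw [mul_one]
  linarith

end IsCascadeTrajectory

/-! ### Dissipation over intervals of joint connectivity. -/

namespace IsSwitchingSignal

variable {P : Type*} {tL : ℝ} {t : ℕ → ℝ} {σ : ℝ → P}

lemma strictMono (h : IsSwitchingSignal tL t σ) (htL : 0 < tL) : StrictMono t :=
  strictMono_nat_of_lt_succ fun k => by linarith [h.dwell k]

lemma nonneg (h : IsSwitchingSignal tL t σ) (htL : 0 < tL) (k : ℕ) : 0 ≤ t k :=
  h.start.ge.trans ((h.strictMono htL).monotone k.zero_le)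

lemma dwell_lt (h : IsSwitchingSignal tL t σ) (htL : 0 < tL) {m n : ℕ} (hmn : m < n) :
    tL < t n - t m := by
  have := (h.strictMono htL).monotone (Nat.succ_le_of_lt hmn)
  linarith [h.dwell m]

end IsSwitchingSignal

/-- If the Lyapunov function drops by at most `d ^ 2` over an interval of joint connectivity, then
the endpoints of each edge of the joint digraph are `O(d)`-close initially. -/
lemma IsCascadeTrajectory.abs_sub_le_of_jointDigraph_adj {P : Type*} {N : ℕ}
    {A : P → Matrix (Fin N) (Fin N) ℝ} {σ : ℝ → P} {a b α β tL T d : ℝ} {v z : ℝ → Fin N → ℝ}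
    {t : ℕ → ℝ} (h : IsCascadeTrajectory (fun s => A (σ s)) α β v z)
    (hA : IsBalancedWithin (fun s => A (σ s)) a b) (hα : 0 < α) (hβ : 0 < β) (htL : 0 < tL)
    (hσ : IsSwitchingSignal tL t σ) {m n : ℕ} (hmn : m ≤ n) (hT : t n - t m ≤ T) (hd : 0 < d)
    (hD : lyapunov α β b (v (t m)) (z (t m)) - lyapunov α β b (v (t n)) (z (t n)) ≤ d ^ 2)
    {i j : Fin N} (hij : (jointDigraph A σ (t m) (t n)).Adj i j) :
    |v (t m) i - v (t m) j| ≤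
      (2 * (β * N * b * T + (4 + 2 * β * b * (N + 1) / α)) + (1 + 2 / (β * a * tL))) * d := by
  set K : ℝ := β * N * b * T + (4 + 2 * β * b * (N + 1) / α) with hK
  set R : ℝ := 1 + 2 / (β * a * tL) with hR
  have ha := hA.pos
  have hb := hA.upper_nonneg
  have hmove : ∀ τ, t m ≤ τ → τ ≤ t n → ∀ l, |v τ l - v (t m) l| ≤ K * d := by
    intro τ h1 h2 l
    have hm := hσ.nonneg htL m
    refine (h.abs_sub_le hA hα hβ hd hm h1 l).trans ?_
    have h3 : lyapunov α β b (v (t m)) (z (t m)) - lyapunov α β b (v τ) (z τ) ≤ d ^ 2 := by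
      linarith [h.lyapunov_antitone hA hα hβ (hm.trans h1) h2]
    calc _ ≤ β * N * b * d * T + (4 + 2 * β * b * (N + 1) / α) / d * d ^ 2 := by
          gcongr
          linarith
      _ = K * d := by
          rw [hK]
          field_simp
  simp only [jointDigraph, Digraph.iSup_adj] at hij
  obtain ⟨s, hs, hadj⟩ := hij
  obtain ⟨k, hmk, hkn, hsk⟩ := exists_mem_Ico_succ hmn hs
  rw [hσ.const k s hsk] at hadj
  have hmono := (hσ.strictMono htL).monotone
  have hRpos : 0 < R := by positivity
  -- Each endpoint moves by at most K d, so a gap above (2K + R) d stays above R d on the whole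
  -- dwell interval of the edge.
  by_contra! hcon
  have hg : ∀ τ ∈ Set.Ico (t k) (t (k + 1)),
      β / 2 * (a * (R * d) ^ 2) ≤ dissipation (A (σ τ)) α β (v τ) (z τ) := by
    intro τ hτ
    have h1 : t m ≤ τ := (hmono hmk).trans hτ.1
    have h2 : τ ≤ t n := hτ.2.le.trans (hmono hkn)
    have hi := abs_le.1 (hmove τ h1 h2 i)
    have hj := abs_le.1 (hmove τ h1 h2 j)
    have h3 : R * d ≤ |v τ i - v τ j| := by
      rcases lt_abs.1 hcon with h4 | h4
      · exact le_abs.2 (Or.inl (by linarith))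
      · exact le_abs.2 (Or.inr (by linarith))
    have h4 : (R * d) ^ 2 ≤ (v τ i - v τ j) ^ 2 := by
      rw [← sq_abs (v τ i - v τ j)]
      exact pow_le_pow_left₀ (by positivity) h3 2
    have hadj' : 0 < A (σ τ) i j := by
      rw [hσ.const k τ hτ]
      exact hadj
    have h5 : a * (R * d) ^ 2 ≤ disagreement (A (σ τ)) (v τ) :=
      (mul_le_mul (hA.le_entry hadj') h4 (sq_nonneg _) hadj'.le).trans
        (mul_sq_le_disagreement (hA.entry_nonneg τ) _ i j)
    have h6 := sumSq_nonneg (z τ)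
    unfold dissipation
    have h7 := mul_le_mul_of_nonneg_left h5 (half_pos hβ).le
    have h8 : 0 ≤ 2 * α * sumSq (z τ) := by positivity
    linarith
  have hk := hσ.nonneg htL k
  have h1 := h.lyapunov_le_sub hA hα hβ hk (hmono k.le_succ) hg
  have h2 := h.lyapunov_antitone hA hα hβ (hσ.nonneg htL m) (hmono hmk)
  have h3 := h.lyapunov_antitone hA hα hβ (hσ.nonneg htL (k + 1)) (hmono hkn)
  have h4 : d ^ 2 ≤ β / 2 * (a * (R * d) ^ 2) * tL := by
    -- With x = βa tL / 2, R = 1 + 1/x satisfies xR = x + 1 and R ≥ 1, hence xR² ≥ 1. The strict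
    -- dwell inequality then makes the loss exceed d².
    have h5 : 1 ≤ β / 2 * a * tL * R ^ 2 := by
      have h6 : β / 2 * a * tL * R = β / 2 * a * tL + 1 := by
        rw [hR]
        field_simp
      have h7 : 1 ≤ R := by
        rw [hR]
        have : 0 ≤ 2 / (β * a * tL) := by positivity
        linarith
      have h8 : 0 < β / 2 * a * tL := by positivity
      rw [sq, ← mul_assoc, h6]
      nlinarith
    calc d ^ 2 = 1 * d ^ 2 := (one_mul _).symm
      _ ≤ β / 2 * a * tL * R ^ 2 * d ^ 2 := by gcongr
      _ = _ := by ring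
  have h5 : β / 2 * (a * (R * d) ^ 2) * tL < β / 2 * (a * (R * d) ^ 2) * (t (k + 1) - t k) :=
    mul_lt_mul_of_pos_left (hσ.dwell k) (by positivity)
  linarith

/-- Over every interval of joint connectivity a fixed fraction of the Lyapunov function is
dissipated. -/
lemma exists_lyapunov_le_mul_sub (N : ℕ) {a b α β tL T : ℝ} (ha : 0 < a) (hab : a ≤ b)
    (hα : 0 < α) (hβ : 0 < β) (htL : 0 < tL) (hT : 0 < T) :
    ∃ C : ℝ, 0 < C ∧ ∀ {P : Type*} (A : P → Matrix (Fin N) (Fin N) ℝ) (σ : ℝ → P)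
      (v z : ℝ → Fin N → ℝ) (t : ℕ → ℝ), IsCascadeTrajectory (fun s => A (σ s)) α β v z →
      IsBalancedWithin (fun s => A (σ s)) a b → IsSwitchingSignal tL t σ →
      ∀ m n : ℕ, m < n → t n - t m ≤ T →
        IsStronglyConnectedDigraph (jointDigraph A σ (t m) (t n)) →
        lyapunov α β b (v (t m)) (z (t m)) ≤
          C * (lyapunov α β b (v (t m)) (z (t m)) - lyapunov α β b (v (t n)) (z (t n))) := by
  obtain ⟨c, hc0, hc⟩ := exists_abs_sub_le_of_isStronglyConnectedDigraph N
  have hb : 0 ≤ b := ha.le.trans hab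
  set R : ℝ := 2 * (β * N * b * T + (4 + 2 * β * b * (N + 1) / α)) + (1 + 2 / (β * a * tL))
    with hR
  have hR0 : 0 < R := by positivity
  -- The fraction of Σ z² that is certainly lost during one dwell time.
  set q : ℝ := 1 - Real.exp (-(2 * α) * tL) with hq
  have hq0 : 0 < q := by
    have : Real.exp (-(2 * α) * tL) < 1 := Real.exp_lt_one_iff.2 (by nlinarith)
    linarith
  set M : ℝ := dampingWeight N α β b with hM
  have hM0 : 0 < M := by
    rw [hM, dampingWeight]
    positivity
  refine ⟨N * (c * R) ^ 2 + M / q, by positivity,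
    fun A σ v z t h hA hσ m n hmn hmT hconn => ?_⟩
  have hmono := (hσ.strictMono htL).monotone
  have hm := hσ.nonneg htL m
  set D : ℝ := lyapunov α β b (v (t m)) (z (t m)) - lyapunov α β b (v (t n)) (z (t n)) with hDdef
  have hD : 0 ≤ D := sub_nonneg.2 (h.lyapunov_antitone hA hα hβ hm (hmono hmn.le))
  have hz : sumSq (z (t m)) ≤ D / q := by
    rw [le_div_iff₀ hq0, hq]
    have h1 := h.sumSq_z_sub_le hA hα hβ hm (hmono hmn.le)
    have h2 := h.sumSq_z_le_exp hm (hmono hmn.le)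
    have h3 : Real.exp (-(2 * α) * (t n - t m)) ≤ Real.exp (-(2 * α) * tL) :=
      Real.exp_le_exp.2 (by nlinarith [hσ.dwell_lt htL hmn])
    have h4 := mul_le_mul_of_nonneg_right h3 (sumSq_nonneg (z (t m)))
    linarith
  have hv : ∀ d, 0 < d → D ≤ d ^ 2 → sumSq (v (t m)) ≤ N * (c * R) ^ 2 * d ^ 2 := by
    intro d hd hDd
    have h1 := hc _ hconn (v (t m)) (R * d) (by positivity) fun i j hij =>
      h.abs_sub_le_of_jointDigraph_adj hA hα hβ htL hσ hmn.le hmT hd hDd hij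
    refine (sumSq_le_of_abs_sub_le (h.sum_v _ hm) h1).trans_eq ?_
    ring
  have hv' : sumSq (v (t m)) ≤ N * (c * R) ^ 2 * D := by
    -- The estimate needs d > 0, because the scale l = d is a divisor. Letting d² decrease to D also
    -- covers D = 0.
    have hlim : Tendsto (fun x : ℝ => N * (c * R) ^ 2 * x) (𝓝[>] D) (𝓝 (N * (c * R) ^ 2 * D)) :=
      ((continuous_const.mul continuous_id).tendsto D).mono_left nhdsWithin_le_nhds
    refine ge_of_tendsto hlim (eventually_mem_nhdsWithin.mono fun x hx => ?_)
    have hx0 : 0 < x := hD.trans_lt hx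
    have := hv (Real.sqrt x) (Real.sqrt_pos.2 hx0) (by rw [Real.sq_sqrt hx0.le]; exact hx.le)
    rwa [Real.sq_sqrt hx0.le] at this
  calc lyapunov α β b (v (t m)) (z (t m)) = sumSq (v (t m)) + M * sumSq (z (t m)) := rfl
    _ ≤ N * (c * R) ^ 2 * D + M * (D / q) := by gcongr
    _ = _ := by ring

/-- Uniform exponential decay of the Lyapunov function along admissible signals. -/
lemma exists_lyapunov_le_exp (N : ℕ) {a b α β tL T : ℝ} (ha : 0 < a) (hab : a ≤ b)
    (hα : 0 < α) (hβ : 0 < β) (htL : 0 < tL) :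
    ∃ κ χ : ℝ, 0 < κ ∧ 0 < χ ∧ ∀ {P : Type*} (A : P → Matrix (Fin N) (Fin N) ℝ) (σ : ℝ → P)
      (v z : ℝ → Fin N → ℝ), IsCascadeTrajectory (fun s => A (σ s)) α β v z →
      IsBalancedWithin (fun s => A (σ s)) a b → IsAdmissibleSignal A tL T σ →
      ∀ s, 0 ≤ s → lyapunov α β b (v s) (z s) ≤
        κ * Real.exp (-χ * s) * lyapunov α β b (v 0) (z 0) := by
  -- T carries no sign condition here; enlarging it makes it a valid divisor.
  have hT : 0 < max T 1 := lt_max_of_lt_right one_pos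
  obtain ⟨C, hC, hCW⟩ := exists_lyapunov_le_mul_sub N ha hab hα hβ htL hT
  refine ⟨Real.exp (1 / C), 1 / C / max T 1, Real.exp_pos _, by positivity,
    fun A σ v z h hA hadm s hs => ?_⟩
  obtain ⟨t, hσ, -, i, hi0, hi, hjoint⟩ := hadm
  have hpos : ∀ s, 0 ≤ lyapunov α β b (v s) (z s) := fun s => by
    have h1 := sumSq_nonneg (v s)
    have h2 := sumSq_nonneg (z s)
    have hb : 0 ≤ b := ha.le.trans hab
    unfold lyapunov dampingWeight
    positivity
  have hstep : ∀ k : ℕ, t (i k) ≤ k * max T 1 ∧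
      lyapunov α β b (v (t (i k))) (z (t (i k))) ≤
        Real.exp (-(1 / C) * k) * lyapunov α β b (v 0) (z 0) := by
    intro k
    induction k with
    | zero => simp [hi0, hσ.start]
    | succ k ih =>
      have hlen : t (i (k + 1)) - t (i k) ≤ max T 1 := (hjoint k).1.trans (le_max_left _ _)
      refine ⟨by push_cast; linarith [ih.1], ?_⟩
      have h1 := hCW A σ v z t h hA hσ (i k) (i (k + 1)) (hi k.lt_succ_self) hlen (hjoint k).2
      set W := lyapunov α β b (v (t (i k))) (z (t (i k)))
      set W' := lyapunov α β b (v (t (i (k + 1)))) (z (t (i (k + 1))))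
      -- This form fits 1 - x ≤ e^{-x}, so the sign of 1 - 1/C is irrelevant.
      have h2 : W' ≤ (-(1 / C) + 1) * W := by
        have h3 : W / C ≤ W - W' := (div_le_iff₀' hC).2 h1
        have e : (-(1 / C) + 1) * W = W - W / C := by ring
        linarith
      calc W' ≤ Real.exp (-(1 / C)) * W :=
            h2.trans (mul_le_mul_of_nonneg_right (Real.add_one_le_exp _) (hpos _))
        _ ≤ Real.exp (-(1 / C)) * (Real.exp (-(1 / C) * k) * lyapunov α β b (v 0) (z 0)) :=
            mul_le_mul_of_nonneg_left ih.2 (Real.exp_pos _).le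
        _ = _ := by
            rw [← mul_assoc, ← Real.exp_add]
            push_cast
            ring_nf
  -- At least n joint intervals are complete by time s; the prefactor exp(1/C) pays for rounding
  -- down.
  set n := ⌊s / max T 1⌋₊ with hn
  have hns : n * max T 1 ≤ s := (le_div_iff₀ hT).1 (Nat.floor_le (by positivity))
  have hsn : s / max T 1 < n + 1 := Nat.lt_floor_add_one _
  refine (h.lyapunov_antitone hA hα hβ (hσ.nonneg htL _) ((hstep n).1.trans hns)).trans
    ((hstep n).2.trans (mul_le_mul_of_nonneg_right ?_ (hpos 0)))
  rw [← Real.exp_add, Real.exp_le_exp]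
  have h1 : 1 / C * (s / max T 1) ≤ 1 / C * (n + 1) := by gcongr
  have e : -(1 / C / max T 1) * s = -(1 / C * (s / max T 1)) := by ring
  rw [e]
  linarith

/-! ### From the switched system to the cascade. -/

lemma outLaplacian_mulVec {N : ℕ} (A : Matrix (Fin N) (Fin N) ℝ) (y : Fin N → ℝ) (i : Fin N) :
    (outLaplacian A).mulVec y i = ∑ j, A i j * (y i - y j) := by
  simp only [outLaplacian, Matrix.sub_mulVec, Pi.sub_apply, Matrix.mulVec_diagonal, outDegree,
    mul_sub, Finset.sum_sub_distrib, Finset.sum_mul]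
  rfl

namespace IsTrajectory

variable {P : Type*} {N : ℕ} {A : P → Matrix (Fin N) (Fin N) ℝ} {α β : ℝ} {σ : ℝ → P}
  {y w : ℝ → Fin N → ℝ}

lemma hasDerivWithinAt_y (h : IsTrajectory A α β σ y w) {t : ℝ} (ht : 0 ≤ t) (i : Fin N) :
    HasDerivWithinAt (fun s => y s i)
      (-(α * y t i) - β * ∑ j, A (σ t) i j * (y t i - y t j) - w t i) (Set.Ici t) t := by
  refine (hasDerivWithinAt_pi.1 (h.deriv t ht) (Sum.inl i)).congr_deriv ?_
  simp [systemMatrix, Matrix.fromBlocks_mulVec, Matrix.sub_mulVec, Matrix.neg_mulVec,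
    Matrix.smul_mulVec, outLaplacian_mulVec]
  ring

lemma hasDerivWithinAt_w (h : IsTrajectory A α β σ y w) {t : ℝ} (ht : 0 ≤ t) (i : Fin N) :
    HasDerivWithinAt (fun s => w s i)
      (α * β * ∑ j, A (σ t) i j * (y t i - y t j)) (Set.Ici t) t := by
  refine (hasDerivWithinAt_pi.1 (h.deriv t ht) (Sum.inr i)).congr_deriv ?_
  simp [systemMatrix, Matrix.fromBlocks_mulVec, Matrix.smul_mulVec, outLaplacian_mulVec]

lemma sum_w (h : IsTrajectory A α β σ y w) (hbal : ∀ s, 0 ≤ s → IsWeightBalanced (A (σ s)))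
    {t : ℝ} (ht : 0 ≤ t) : ∑ i, w t i = ∑ i, w 0 i := by
  refine constant_of_has_deriv_right_zero (f := fun t => ∑ i, w t i) (a := 0) (b := t)
    (continuousOn_finsetSum _ fun i _ => ((continuousOn_pi.1 h.cont_w) i).mono fun s hs => hs.1)
    (fun s hs => ?_) t (Set.right_mem_Icc.2 ht)
  refine (HasDerivWithinAt.fun_sum fun i _ => h.hasDerivWithinAt_w hs.1 i).congr_deriv ?_
  rw [← Finset.mul_sum, (hbal s hs.1).sum_sub_eq_zero, mul_zero]

/-- In the coordinates `v = w - avg (w 0)` and `z = w + α y` the system is a cascade. -/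
lemma isCascadeTrajectory (h : IsTrajectory A α β σ y w)
    (hbal : ∀ s, 0 ≤ s → IsWeightBalanced (A (σ s))) :
    IsCascadeTrajectory (fun s => A (σ s)) α β (fun t i => w t i - avg (w 0))
      (fun t i => w t i + α * y t i) where
  cont_v := continuousOn_pi.2 fun i => ((continuousOn_pi.1 h.cont_w) i).sub continuousOn_const
  cont_z := continuousOn_pi.2 fun i => ((continuousOn_pi.1 h.cont_w) i).add
    (continuousOn_const.mul ((continuousOn_pi.1 h.cont_y) i))
  deriv_v t ht i := by
    refine ((h.hasDerivWithinAt_w ht i).sub_const _).congr_deriv ?_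
    rw [consensusFlow, Finset.mul_sum, Finset.mul_sum]
    exact Finset.sum_congr rfl fun j _ => by ring
  deriv_z t ht i := by
    refine ((h.hasDerivWithinAt_w ht i).add
      ((h.hasDerivWithinAt_y ht i).const_mul α)).congr_deriv ?_
    ring
  sum_v t ht := by
    rcases Nat.eq_zero_or_pos N with rfl | hN
    · simp
    · have hN' : (N : ℝ) ≠ 0 := by exact_mod_cast hN.ne'
      rw [Finset.sum_sub_distrib, h.sum_w hbal ht]
      simp [avg, mul_div_cancel₀ _ hN']

end IsTrajectory

/-! ### Equivalence of the Lyapunov function and the squared error norm. -/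

lemma norm_stackedState_sub_sq {N : ℕ} (y w y' w' : Fin N → ℝ) :
    ‖stackedState y w - stackedState y' w'‖ ^ 2 =
      sumSq (fun i => y i - y' i) + sumSq (fun i => w i - w' i) := by
  rw [EuclideanSpace.norm_sq_eq]
  simp [stackedState, sumSq, Fintype.sum_sum_type]

section Equivalence

variable {N : ℕ} {α : ℝ} (y w : Fin N → ℝ) (m : ℝ)

lemma sumSq_output_error_le (hα : 0 < α) :
    sumSq (fun i => y i - -(α⁻¹ * m)) ≤
      2 / α ^ 2 * (sumSq (fun i => w i - m) + sumSq (fun i => w i + α * y i)) := by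
  simp only [sumSq, ← Finset.sum_add_distrib, Finset.mul_sum]
  refine Finset.sum_le_sum fun i _ => ?_
  -- The error of y is (z - v) / α.
  have e : y i - -(α⁻¹ * m) = ((w i + α * y i) - (w i - m)) / α := by
    field_simp
    ring
  rw [e, div_pow, div_mul_eq_mul_div]
  gcongr
  nlinarith [sq_nonneg ((w i + α * y i) + (w i - m))]

lemma sumSq_damped_le (hα : 0 < α) :
    sumSq (fun i => w i + α * y i) ≤
      2 * α ^ 2 * sumSq (fun i => y i - -(α⁻¹ * m)) + 2 * sumSq (fun i => w i - m) := by
  simp only [sumSq, ← Finset.sum_add_distrib, Finset.mul_sum]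
  refine Finset.sum_le_sum fun i _ => ?_
  have e : w i + α * y i = α * (y i - -(α⁻¹ * m)) + (w i - m) := by
    field_simp
    ring
  rw [e]
  nlinarith [sq_nonneg (α * (y i - -(α⁻¹ * m)) - (w i - m))]

end Equivalence

lemma exists_sq_bounds_lyapunov (N : ℕ) {α β b : ℝ} (hα : 0 < α) (hβ : 0 < β) (hb : 0 ≤ b) :
    ∃ c₁ c₂ : ℝ, 0 < c₁ ∧ 0 < c₂ ∧ ∀ (y w : Fin N → ℝ) (m : ℝ),
      ‖stackedState y w - stackedState (fun _ => -(α⁻¹ * m)) (fun _ => m)‖ ^ 2 ≤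
          c₁ * lyapunov α β b (fun i => w i - m) (fun i => w i + α * y i) ∧
        lyapunov α β b (fun i => w i - m) (fun i => w i + α * y i) ≤
          c₂ * ‖stackedState y w - stackedState (fun _ => -(α⁻¹ * m)) (fun _ => m)‖ ^ 2 := by
  set M := dampingWeight N α β b with hM
  have hM1 : 1 ≤ M := by
    have : 0 ≤ β * N * b / α := by positivity
    rw [hM, dampingWeight]
    linarith
  refine ⟨2 / α ^ 2 + 1, 1 + 2 * M + 2 * M * α ^ 2, by positivity, by positivity,
    fun y w m => ?_⟩
  rw [norm_stackedState_sub_sq]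
  have h1 := sumSq_output_error_le y w m hα
  have h2 := sumSq_damped_le y w m hα
  unfold lyapunov
  rw [← hM]
  set V := sumSq fun i => w i - m
  set Y := sumSq fun i => y i - -(α⁻¹ * m)
  set Q := sumSq fun i => w i + α * y i
  have hV : 0 ≤ V := sumSq_nonneg _
  have hY : 0 ≤ Y := sumSq_nonneg _
  have hQ : 0 ≤ Q := sumSq_nonneg _
  have hMQ : Q ≤ M * Q := le_mul_of_one_le_left hQ hM1
  constructor
  · have h3 : 2 / α ^ 2 * (V + Q) ≤ 2 / α ^ 2 * (V + M * Q) := by gcongr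
    linarith
  · have h3 := mul_le_mul_of_nonneg_left h2 (zero_le_one.trans hM1)
    have h4 : 0 ≤ 2 * M * α ^ 2 * V := by positivity
    have h5 : 0 ≤ (1 + 2 * M) * Y := by positivity
    linarith

/-! ### The main theorem. -/

theorem mainTheorem4 {P : Type*} {N : ℕ} (A : P → Matrix (Fin N) (Fin N) ℝ)
    (hA : HasUniformWeights A) (S : Set (ℝ → P)) (hS : IsAdmissibleSet A S)
    (α β : ℝ) (hα : 0 < α) (hβ : 0 < β) :
    ∃ κ χ : ℝ, 0 < κ ∧ 0 < χ ∧
      ∀ σ ∈ S, ∀ y w : ℝ → Fin N → ℝ, IsTrajectory A α β σ y w →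
        (∀ i, Tendsto (fun t => y t i) atTop (𝓝 (-(α⁻¹ / N) * ∑ j, w 0 j)) ∧
          Tendsto (fun t => w t i) atTop (𝓝 (avg (w 0)))) ∧
        ∀ t, 0 ≤ t →
          ‖stackedState (y t) (w t) -
              stackedState (fun _ => -(α⁻¹ / N) * ∑ j, w 0 j) (fun _ => avg (w 0))‖ ≤
            κ * Real.exp (-χ * t) *
              ‖stackedState (y 0) (w 0) -
                stackedState (fun _ => -(α⁻¹ / N) * ∑ j, w 0 j) (fun _ => avg (w 0))‖ := by
  obtain ⟨a, b, ha, hab, hw⟩ := hA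
  obtain ⟨tL, T, htL, hS⟩ := hS
  obtain ⟨c₁, c₂, hc₁, hc₂, hc⟩ := exists_sq_bounds_lyapunov N hα hβ (ha.le.trans hab)
  obtain ⟨κ, χ, hκ, hχ, hdecay⟩ := exists_lyapunov_le_exp N (T := T) ha hab hα hβ htL
  -- The Lyapunov function is quadratic in the error, hence the square root and the halved rate.
  refine ⟨Real.sqrt (c₁ * κ * c₂), χ / 2, by positivity, by positivity,
    fun σ hσ y w htraj => ?_⟩
  have hlim : -(α⁻¹ / N) * ∑ j, w 0 j = -(α⁻¹ * avg (w 0)) := by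
    unfold avg
    ring
  rw [hlim]
  have hbal : ∀ s, 0 ≤ s → IsWeightBalanced (A (σ s)) := by
    obtain ⟨t, -, h, -⟩ := hS σ hσ
    exact h
  have hbound := hdecay A σ _ _ (htraj.isCascadeTrajectory hbal)
    ⟨ha, hab, fun t => hw (σ t), hbal⟩ (hS σ hσ)
  set m := avg (w 0)
  have hexp : ∀ t, 0 ≤ t →
      ‖stackedState (y t) (w t) - stackedState (fun _ => -(α⁻¹ * m)) (fun _ => m)‖ ≤
        Real.sqrt (c₁ * κ * c₂) * Real.exp (-(χ / 2) * t) *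
          ‖stackedState (y 0) (w 0) - stackedState (fun _ => -(α⁻¹ * m)) (fun _ => m)‖ := by
    intro t ht
    rw [← pow_le_pow_iff_left₀ (norm_nonneg _) (by positivity) two_ne_zero, mul_pow, mul_pow,
      Real.sq_sqrt (by positivity), ← Real.exp_nat_mul]
    refine (hc (y t) (w t) m).1.trans ?_
    calc _ ≤ c₁ * (κ * Real.exp (-χ * t) * (c₂ * ‖stackedState (y 0) (w 0) -
            stackedState (fun _ => -(α⁻¹ * m)) (fun _ => m)‖ ^ 2)) := by
          refine mul_le_mul_of_nonneg_left ((hbound t ht).trans ?_) hc₁.le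
          exact mul_le_mul_of_nonneg_left (hc (y 0) (w 0) m).2 (by positivity)
      _ = _ := by
          have e : ((2 : ℕ) : ℝ) * (-(χ / 2) * t) = -χ * t := by
            push_cast
            ring
          rw [e]
          ring
  refine ⟨fun i => ?_, hexp⟩
  have hzero : Tendsto (fun t => Real.sqrt (c₁ * κ * c₂) * Real.exp (-(χ / 2) * t) *
      ‖stackedState (y 0) (w 0) - stackedState (fun _ => -(α⁻¹ * m)) (fun _ => m)‖)
      atTop (𝓝 0) := by
    have h1 : Tendsto (fun t : ℝ => Real.exp (-(χ / 2) * t)) atTop (𝓝 0) :=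
      Real.tendsto_exp_atBot.comp
        (tendsto_id.const_mul_atTop_of_neg (neg_lt_zero.2 (half_pos hχ)))
    simpa using (h1.const_mul (Real.sqrt (c₁ * κ * c₂))).mul_const
      ‖stackedState (y 0) (w 0) - stackedState (fun _ => -(α⁻¹ * m)) (fun _ => m)‖
  constructor
  · refine tendsto_iff_norm_sub_tendsto_zero.2 (squeeze_zero' (.of_forall fun _ => norm_nonneg _)
      ((eventually_ge_atTop 0).mono fun t ht => ?_) hzero)
    exact (PiLp.norm_apply_le (stackedState (y t) (w t) -
      stackedState (fun _ => -(α⁻¹ * m)) (fun _ => m)) (Sum.inl i)).trans (hexp t ht)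
  · refine tendsto_iff_norm_sub_tendsto_zero.2 (squeeze_zero' (.of_forall fun _ => norm_nonneg _)
      ((eventually_ge_atTop 0).mono fun t ht => ?_) hzero)
    exact (PiLp.norm_apply_le (stackedState (y t) (w t) -
      stackedState (fun _ => -(α⁻¹ * m)) (fun _ => m)) (Sum.inr i)).trans (hexp t ht)
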